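/- Let $\widetilde{PSL_2\mathbb R}$ be the universal covering group of $PSL_2\mathbb R=\mathrm{Isom}^+(\mathbb H^2)$, i.e. the group of homotopy classes, relative to endpoints, of paths $[0,1]\to PSL_2\mathbb R$ starting at $1$, with multiplication induced by pointwise multiplication of paths. Let $z\in\widetilde{PSL_2\mathbb R}$ be the class of the path $t\mapsto$ (anticlockwise rotation through angle $2\pi t$ about $i$ in the upper half plane), $0\le t\le1$; it generates the group of lifts of the identity. Define the following subsets of $\widetilde{PSL_2\mathbb R}$. - $\mathrm{Hyp}_0$ is the set of classes of paths $t\mapsto$ (translation through signed distance $td$ along $\ell$), $0\le t\le 1$, where $\ell$ is an oriented geodesic of $\mathbb H^2$ and $d\neq0$ (the simplest lifts of hyperbolic isometries). $\mathrm{Hyp}_n=z^n\,\mathrm{Hyp}_0$ for $n\in\mathbb Z$. - $\mathrm{Par}_0^+$ (resp. $\mathrm{Par}_0^-$) is the set of classes of paths $t\mapsto g\circ(w\mapsto w+td)\circ g^{-1}$, $0\le t\le1$, with $g\in PSL_2\mathbb R$ and $d>0$ (resp. $d<0$), where $w$ is the coordinate of the upper half plane (the simplest lifts of parabolic isometries that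 rotate anticlockwise, resp. clockwise, about their fixed point at infinity). $\mathrm{Par}_n^\pm=z^n\,\mathrm{Par}_0^\pm$ for $n\in\mathbb Z$, and $\mathrm{Par}_n=\mathrm{Par}_n^+\cup\mathrm{Par}_n^-$. - $\mathrm{Ell}_1$ (resp. $\mathrm{Ell}_{-1}$) is the set of classes of paths $t\mapsto$ (anticlockwise rotation about $p$ through signed angle $t\psi$), $0\le t\le 1$, with $p\in\mathbb H^2$ and $\psi\in(0,2\pi)$ (resp. $\psi\in(-2\pi,0)$). For $n>0$, $\mathrm{Ell}_n=z^{n-1}\,\mathrm{Ell}_1$ and $\mathrm{Ell}_{-n}=z^{-n+1}\,\mathrm{Ell}_{-1}$; and $\mathrm{Ell}_0=\emptyset$. **Theorem.** For all $\tilde\alpha,\tilde\beta\in\widetilde{PSL_2\mathbb R}$, $$[\tilde\alpha,\tilde\beta]=\tilde\alpha\tilde\beta\tilde\alpha^{-1}\tilde\beta^{-1}\in\{1\}\cup\Bigl(\bigcup_{n=-1}^{1}\mathrm{Hyp}_n\cup\mathrm{Ell}_n\Bigr)\cup\mathrm{Par}_0\cup\mathrm{Par}_{-1}^+\cup\mathrm{Par}_1^-.$$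 -/

import Mathlib

/-- The group (under pointwise multiplication) of continuous paths `[0,1] → G` starting at `1`. -/
def basedPaths (G : Type*) [Group G] [TopologicalSpace G] [IsTopologicalGroup G] :
    Subgroup C(unitInterval, G) where
  carrier := {γ | γ 0 = 1}
  mul_mem' := by
    intro a b ha hb
    simp only [Set.mem_ofPred_eq, ContinuousMap.mul_apply] at *
    rw [ha, hb, mul_one]
  one_mem' := rfl
  inv_mem' := by
    intro a ha
    simp only [Set.mem_ofPred_eq, ContinuousMap.inv_apply] at *
    rw [ha, inv_one]

/-- Homotopy of paths relative to both endpoints; it is compatible with pointwise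
multiplication. -/
def pathHomotopyCon (G : Type*) [Group G] [TopologicalSpace G] [IsTopologicalGroup G] :
    Con (basedPaths G) where
  r γ δ := ContinuousMap.HomotopicRel (γ : C(unitInterval, G)) (δ : C(unitInterval, G)) {0, 1}
  iseqv :=
    ⟨fun γ => ContinuousMap.HomotopicRel.refl γ.1, fun h => h.symm, fun h k => h.trans k⟩
  mul' := by
    rintro a b c d ⟨F⟩ ⟨K⟩
    refine ⟨{ toFun := fun x => F x * K x
              continuous_toFun := by fun_prop
              map_zero_left := fun t => by simp
              map_one_left := fun t => by simp
              prop' := fun s t ht => ?_ }⟩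
    change F (s, t) * K (s, t) = a.1 t * c.1 t
    rw [F.eq_fst s ht, K.eq_fst s ht]

/-- The universal covering group of a topological group `G` (path connected, locally path
connected and semilocally simply connected, such as a connected Lie group): homotopy classes
relative to endpoints of paths in `G` that start at `1`, with the product of two classes given
by pointwise multiplication of paths. The covering projection is `[γ] ↦ γ 1`. -/
abbrev UniversalCover (G : Type*) [Group G] [TopologicalSpace G] [IsTopologicalGroup G] :=
  (pathHomotopyCon G).Quotient

/-- The element of the universal covering group represented by a path starting at `1`. -/
def UniversalCover.ofPath {G : Type*} [Group G] [TopologicalSpace G] [IsTopologicalGroup G]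
    (c : C(unitInterval, G)) (hc : c 0 = 1) : UniversalCover G :=
  Con.toQuotient (⟨c, hc⟩ : basedPaths G)

namespace PSL2

open scoped Pointwise

/-- `PSL₂(ℝ)`, with the quotient topology from `SL₂(ℝ)`. -/
abbrev PSL2R := Matrix.ProjectiveSpecialLinearGroup (Fin 2) ℝ

/-- The universal covering group of `PSL₂(ℝ)`. -/
abbrev PSL2RCover := UniversalCover PSL2R

/-- The class in `PSL₂(ℝ)` of a matrix in `SL₂(ℝ)`. -/
def proj (A : Matrix.SpecialLinearGroup (Fin 2) ℝ) : PSL2R := QuotientGroup.mk A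

theorem continuous_proj : Continuous proj := QuotientGroup.continuous_mk

/-- Acts on the upper half plane as `w ↦ exp d * w`, the translation through signed hyperbolic
distance `d` along the geodesic from `0` to `∞`. -/
noncomputable def translation (d : ℝ) : Matrix.SpecialLinearGroup (Fin 2) ℝ :=
  ⟨!![Real.exp (d / 2), 0; 0, Real.exp (-(d / 2))], by
    rw [Matrix.det_fin_two_of, ← Real.exp_add]; simp⟩

/-- Acts on the upper half plane as `w ↦ w + d`, which moves points along the horocycles about
`∞`. For `d > 0` this is anticlockwise about `∞`: it is a limit of anticlockwise rotations about
points `T * I`, `T → ∞`, which move the points below their centre to the right. -/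
def horocyclic (d : ℝ) : Matrix.SpecialLinearGroup (Fin 2) ℝ :=
  ⟨!![1, d; 0, 1], by rw [Matrix.det_fin_two_of]; simp⟩

/-- Acts on the upper half plane as the anticlockwise rotation about `I` through the angle `ψ`:
it fixes `I`, and its derivative there is `exp (ψ * I)`. -/
noncomputable def rotation (ψ : ℝ) : Matrix.SpecialLinearGroup (Fin 2) ℝ :=
  ⟨!![Real.cos (ψ / 2), Real.sin (ψ / 2); -Real.sin (ψ / 2), Real.cos (ψ / 2)], by
    rw [Matrix.det_fin_two_of, mul_neg, sub_neg_eq_add, ← sq, ← sq, Real.cos_sq_add_sin_sq]⟩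

theorem continuous_translation : Continuous translation := by
  refine Continuous.subtype_mk (continuous_matrix fun i j => ?_) _
  fin_cases i <;> fin_cases j <;> simp <;> fun_prop

theorem continuous_horocyclic : Continuous horocyclic := by
  refine Continuous.subtype_mk (continuous_matrix fun i j => ?_) _
  fin_cases i <;> fin_cases j <;> simp <;> fun_prop

theorem continuous_rotation : Continuous rotation := by
  refine Continuous.subtype_mk (continuous_matrix fun i j => ?_) _
  fin_cases i <;> fin_cases j <;> simp <;> fun_prop

theorem translation_zero : translation 0 = 1 := by
  ext i j; fin_cases i <;> fin_cases j <;> simp [translation]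

theorem horocyclic_zero : horocyclic 0 = 1 := by
  ext i j; fin_cases i <;> fin_cases j <;> simp [horocyclic]

theorem rotation_zero : rotation 0 = 1 := by
  ext i j; fin_cases i <;> fin_cases j <;> simp [rotation]

/-- For a continuous family `f : ℝ → SL₂(ℝ)` with `f 0 = 1`, the element of the universal cover
represented by the path `t ↦ g * f (t * s) * g⁻¹` in `PSL₂(ℝ)`, `t ∈ [0,1]`. -/
def conjPathLift (f : ℝ → Matrix.SpecialLinearGroup (Fin 2) ℝ) (hf : Continuous f)
    (h0 : f 0 = 1) (g : Matrix.SpecialLinearGroup (Fin 2) ℝ) (s : ℝ) : PSL2RCover :=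
  UniversalCover.ofPath
    ⟨fun t : unitInterval => proj (g * f ((t : ℝ) * s) * g⁻¹),
      continuous_proj.comp (by fun_prop)⟩
    (by
      change proj (g * f (((0 : unitInterval) : ℝ) * s) * g⁻¹) = 1
      rw [Set.Icc.coe_zero, zero_mul, h0, mul_one, mul_inv_cancel]
      rfl)

/-- The simplest lift of the translation through signed distance `d` along the geodesic from
`g • 0` to `g • ∞`. -/
noncomputable def translationLift (g : Matrix.SpecialLinearGroup (Fin 2) ℝ) (d : ℝ) :
    PSL2RCover :=
  conjPathLift translation continuous_translation translation_zero g d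

/-- The simplest lift of the parabolic conjugate by `g` to `w ↦ w + d`, which fixes the point at
infinity `g • ∞`. -/
noncomputable def horocyclicLift (g : Matrix.SpecialLinearGroup (Fin 2) ℝ) (d : ℝ) :
    PSL2RCover :=
  conjPathLift horocyclic continuous_horocyclic horocyclic_zero g d

/-- The path of rotations about the point `g • I` through angles from `0` to `ψ`. -/
noncomputable def rotationLift (g : Matrix.SpecialLinearGroup (Fin 2) ℝ) (ψ : ℝ) :
    PSL2RCover :=
  conjPathLift rotation continuous_rotation rotation_zero g ψ

/-- The lift of the identity given by one full anticlockwise turn. -/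
noncomputable def z : PSL2RCover := rotationLift 1 (2 * Real.pi)

/-- Simplest lifts of hyperbolic isometries. -/
def HypZero : Set PSL2RCover := {x | ∃ g, ∃ d : ℝ, d ≠ 0 ∧ x = translationLift g d}

/-- Simplest lifts of anticlockwise parabolic isometries. -/
def ParZeroPos : Set PSL2RCover := {x | ∃ g, ∃ d : ℝ, 0 < d ∧ x = horocyclicLift g d}

/-- Simplest lifts of clockwise parabolic isometries. -/
def ParZeroNeg : Set PSL2RCover := {x | ∃ g, ∃ d : ℝ, d < 0 ∧ x = horocyclicLift g d}

/-- Simplest anticlockwise lifts of elliptic isometries. -/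
def EllOne : Set PSL2RCover :=
  {x | ∃ g, ∃ ψ : ℝ, 0 < ψ ∧ ψ < 2 * Real.pi ∧ x = rotationLift g ψ}

/-- Simplest clockwise lifts of elliptic isometries. -/
def EllNegOne : Set PSL2RCover :=
  {x | ∃ g, ∃ ψ : ℝ, -(2 * Real.pi) < ψ ∧ ψ < 0 ∧ x = rotationLift g ψ}

/-- `Hyp_n = zⁿ Hyp_0`. -/
noncomputable def Hyp (n : ℤ) : Set PSL2RCover := z ^ n • HypZero

/-- `Par_n^+ = zⁿ Par_0^+`. -/
noncomputable def ParPos (n : ℤ) : Set PSL2RCover := z ^ n • ParZeroPos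

/-- `Par_n^- = zⁿ Par_0^-`. -/
noncomputable def ParNeg (n : ℤ) : Set PSL2RCover := z ^ n • ParZeroNeg

/-- `Par_n`, the union of `Par_n^+` and `Par_n^-`. -/
noncomputable def Par (n : ℤ) : Set PSL2RCover := ParPos n ∪ ParNeg n

/-- `Ell_n = z^(n-1) Ell_1` for `n > 0`, `Ell_n = z^(n+1) Ell_{-1}` for `n < 0`, and
`Ell_0 = ∅`. -/
noncomputable def Ell (n : ℤ) : Set PSL2RCover :=
  if 0 < n then z ^ (n - 1) • EllOne
  else if n < 0 then z ^ (n + 1) • EllNegOne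
  else ∅

end PSL2

/-! `PSL₂(ℝ)` acts on the circle at infinity, so its universal cover acts on the line by increasing
maps commuting with `u ↦ u + 1` (`lineAction`), and `z` acts as that unit translation. An element of
the cover is determined by its endpoint in `PSL₂(ℝ)` and the image of `0` (`eq_of_endpoint_eq`).
Hence `z` is central and its powers form the kernel of `endpoint`.

A commutator cannot move every point right by `1` or more. If it did, then `ab` would dominate `ba`
followed by a unit translation. Conjugate maps have equal translation numbers and `ba` is conjugate
to `ab`, which would give `τ + 1 ≤ τ`. Inverting the commutator gives the same for leftward moves.

The endpoint of a commutator is `1` or is conjugate to a translation, a parabolic or a rotation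
(`hasNormalForm`), so the commutator is `z ^ n` times an explicit lift of it. How that lift moves
points then bounds `n`: translations and parabolics fix `0`, parabolics move all points weakly in
one direction, and a rotation by `ψ` shifts the line by `ψ / 2π`, which lies strictly between `0`
and `1`. -/

namespace PSL2

open Matrix Matrix.SpecialLinearGroup

/-! ### The circle at infinity and the orbit of its base point. -/

/-- The covering of the circle by the line with deck group `ℤ`. -/
noncomputable def circ (u : ℝ) : Circle := Circle.exp (2 * Real.pi * u)

theorem isCoveringMap_circ : IsCoveringMap circ := fun x => by
  have := (Circle.isCoveringMap_exp x).comp_homeomorph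
    (Homeomorph.mulLeft₀ (2 * Real.pi) Real.two_pi_pos.ne')
  exact this.to_isEvenlyCovered_preimage

theorem circ_eq_circ_iff {u v : ℝ} : circ u = circ v ↔ ∃ n : ℤ, u = v + n := by
  rw [circ, circ, Circle.exp_eq_exp]
  refine exists_congr fun n => ⟨fun h => ?_, fun h => by rw [h]; ring⟩
  have := Real.two_pi_pos
  nlinarith [mul_left_cancel₀ this.ne' (show 2 * Real.pi * u = 2 * Real.pi * (v + n) by
    rw [h]; ring)]

/-- The first column of a matrix as a complex number. -/
noncomputable def column (A : SpecialLinearGroup (Fin 2) ℝ) : ℂ := ⟨A 0 0, A 1 0⟩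

theorem ext_entries {A B : SpecialLinearGroup (Fin 2) ℝ} (h₀₀ : A 0 0 = B 0 0) (h₀₁ : A 0 1 = B 0 1)
    (h₁₀ : A 1 0 = B 1 0) (h₁₁ : A 1 1 = B 1 1) : A = B := by
  refine Subtype.ext (Matrix.ext fun i j => ?_)
  fin_cases i <;> fin_cases j <;> assumption

theorem mul_entry (A B : SpecialLinearGroup (Fin 2) ℝ) (i j : Fin 2) :
    (A * B) i j = A i 0 * B 0 j + A i 1 * B 1 j := by
  change (A.1 * B.1) i j = _
  rw [Matrix.mul_apply, Fin.sum_univ_two]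

theorem neg_entry (A : SpecialLinearGroup (Fin 2) ℝ) (i j : Fin 2) : (-A) i j = -A i j := rfl

theorem one_entry (i j : Fin 2) :
    (1 : SpecialLinearGroup (Fin 2) ℝ) i j = if i = j then 1 else 0 := rfl

theorem rotation_entries (ψ : ℝ) :
    rotation ψ 0 0 = Real.cos (ψ / 2) ∧ rotation ψ 0 1 = Real.sin (ψ / 2) ∧
    rotation ψ 1 0 = -Real.sin (ψ / 2) ∧ rotation ψ 1 1 = Real.cos (ψ / 2) :=
  ⟨rfl, rfl, rfl, rfl⟩

theorem det_eq (A : SpecialLinearGroup (Fin 2) ℝ) : A 0 0 * A 1 1 - A 0 1 * A 1 0 = 1 := by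
  have := A.det_coe
  rwa [Matrix.det_fin_two] at this

theorem column_ne_zero (A : SpecialLinearGroup (Fin 2) ℝ) : column A ≠ 0 := fun h => by
  have h0 : A 0 0 = 0 := congrArg Complex.re h
  have h1 : A 1 0 = 0 := congrArg Complex.im h
  simpa [h0, h1] using det_eq A

/-- Twice the clockwise angle of the first column of a matrix, as a point of the circle. -/
noncomputable def dirSL (A : SpecialLinearGroup (Fin 2) ℝ) : Circle :=
  Circle.ofConjDivSelf (column A) (column_ne_zero A)

theorem coe_dirSL (A : SpecialLinearGroup (Fin 2) ℝ) :
    (dirSL A : ℂ) = (starRingEnd ℂ) (column A) / column A := rfl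

theorem continuous_entry (i j : Fin 2) :
    Continuous fun A : SpecialLinearGroup (Fin 2) ℝ => A i j :=
  (continuous_subtype_val).matrix_elem i j

theorem continuous_column : Continuous column := by
  have : column = fun A => ((A 0 0 : ℝ) : ℂ) + ((A 1 0 : ℝ) : ℂ) * Complex.I := by
    funext A
    apply Complex.ext <;> simp [column]
  rw [this]
  have h0 := continuous_entry 0 0
  have h1 := continuous_entry 1 0
  fun_prop

theorem continuous_dirSL : Continuous dirSL :=
  Continuous.subtype_mk ((Complex.continuous_conj.comp continuous_column).div continuous_column
    column_ne_zero) _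

/-- The quotient `conj c / c` remembers exactly the real line spanned by `c`, so equality means that
the first columns are parallel. -/
theorem dirSL_eq_iff {A B : SpecialLinearGroup (Fin 2) ℝ} :
    dirSL A = dirSL B ↔ A 0 0 * B 1 0 = A 1 0 * B 0 0 := by
  rw [← Circle.coe_inj, coe_dirSL, coe_dirSL, div_eq_div_iff (column_ne_zero A) (column_ne_zero B),
    Complex.ext_iff]
  simp only [column, Complex.mul_re, Complex.mul_im, Complex.conj_re, Complex.conj_im]
  constructor
  · rintro ⟨-, h⟩
    linarith
  · intro h
    constructor <;> linarith

/-- Left multiplication scales the cross product of two columns by `det g`. This makes the action on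
the circle well defined while only orbits of the base point are ever used. -/
theorem dirSL_mul_congr {A B : SpecialLinearGroup (Fin 2) ℝ} (g : SpecialLinearGroup (Fin 2) ℝ)
    (h : dirSL A = dirSL B) : dirSL (g * A) = dirSL (g * B) := by
  rw [dirSL_eq_iff] at h ⊢
  simp only [mul_entry]
  linear_combination (g 0 0 * g 1 1 - g 0 1 * g 1 0) * h

theorem dirSL_mul_upper (A U : SpecialLinearGroup (Fin 2) ℝ) (h : U 1 0 = 0) :
    dirSL (A * U) = dirSL A := by
  rw [dirSL_eq_iff]
  simp only [mul_entry, h]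
  ring

theorem proj_eq_iff {A B : SpecialLinearGroup (Fin 2) ℝ} : proj A = proj B ↔ A = B ∨ A = -B := by
  rw [proj, proj, QuotientGroup.eq, Matrix.SpecialLinearGroup.mem_center_iff]
  constructor
  · rintro ⟨r, hr, h⟩
    have hB : ∀ i j, B i j = r * A i j := fun i j => by
      have h' : B = A * (A⁻¹ * B) := by group
      have hs : ∀ k l, (A⁻¹ * B) k l = if k = l then r else 0 := fun k l => by
        rw [show (A⁻¹ * B) k l = scalar (Fin 2) r k l from (congrFun (congrFun h k) l).symm]
        simp [Matrix.diagonal_apply]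
      rw [h', mul_entry, hs, hs]
      fin_cases j <;> simp [mul_comm]
    rw [Fintype.card_fin] at hr
    rcases sq_eq_sq_iff_eq_or_eq_neg.mp (hr.trans (one_pow 2).symm) with rfl | rfl
    · left
      apply ext_entries <;> rw [hB, one_mul]
    · right
      apply ext_entries <;> rw [neg_entry, hB] <;> ring
  · rintro (rfl | rfl)
    · exact ⟨1, by simp, by simp⟩
    · refine ⟨-1, by simp, ?_⟩
      have : (-B)⁻¹ * B = -1 := by rw [inv_neg, neg_mul, inv_mul_cancel]
      rw [this]
      ext i j
      fin_cases i <;> fin_cases j <;> simp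

theorem proj_neg (A : SpecialLinearGroup (Fin 2) ℝ) : proj (-A) = proj A :=
  proj_eq_iff.mpr (Or.inr rfl)

theorem proj_mul (A B : SpecialLinearGroup (Fin 2) ℝ) : proj (A * B) = proj A * proj B := rfl

theorem proj_inv (A : SpecialLinearGroup (Fin 2) ℝ) : proj A⁻¹ = (proj A)⁻¹ := rfl

theorem proj_one : proj 1 = 1 := rfl

theorem proj_surjective : Function.Surjective proj := QuotientGroup.mk_surjective

/-- A function on `SL₂(ℝ)` that does not see the sign, as a function on `PSL₂(ℝ)`. -/
def descend {X : Type*} (f : SpecialLinearGroup (Fin 2) ℝ → X) (hf : ∀ A, f (-A) = f A) :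
    PSL2R → X :=
  Quotient.lift f fun A B h => by
    rcases proj_eq_iff.mp (Quotient.sound h : proj A = proj B) with rfl | rfl
    · rfl
    · exact hf B

theorem continuous_descend {X : Type*} [TopologicalSpace X]
    {f : SpecialLinearGroup (Fin 2) ℝ → X} (hf : ∀ A, f (-A) = f A) (h : Continuous f) :
    Continuous (descend f hf) :=
  h.quotient_lift _

theorem dirSL_neg (A : SpecialLinearGroup (Fin 2) ℝ) : dirSL (-A) = dirSL A := by
  rw [dirSL_eq_iff]
  simp
  ring

/-- The action of `PSL₂(ℝ)` on the base point of the circle at infinity. -/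
noncomputable def dir : PSL2R → Circle := descend dirSL dirSL_neg

theorem continuous_dir : Continuous dir := continuous_descend _ continuous_dirSL

theorem dir_mul_congr {x y : PSL2R} (g : PSL2R) (h : dir x = dir y) : dir (g * x) = dir (g * y) := by
  obtain ⟨A, rfl⟩ := proj_surjective x
  obtain ⟨B, rfl⟩ := proj_surjective y
  obtain ⟨G, rfl⟩ := proj_surjective g
  exact dirSL_mul_congr G h

theorem dirSL_rotation (ψ : ℝ) : dirSL (rotation ψ) = Circle.exp ψ := by
  have hc : column (rotation ψ) = Complex.exp ((-(ψ / 2) : ℝ) * Complex.I) := by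
    rw [Complex.exp_mul_I, ← Complex.ofReal_cos, ← Complex.ofReal_sin]
    apply Complex.ext
    · rw [Complex.add_re, Complex.ofReal_re, Complex.re_ofReal_mul, Complex.I_re, Real.cos_neg]
      simp [column, rotation]
    · rw [Complex.add_im, Complex.ofReal_im, Complex.im_ofReal_mul, Complex.I_im, Real.sin_neg]
      simp [column, rotation]
  rw [← Circle.coe_inj, coe_dirSL, hc, ← Complex.exp_conj, ← Complex.exp_sub, Circle.coe_exp]
  congr 1
  rw [map_mul, Complex.conj_ofReal, Complex.conj_I]
  push_cast
  ring

/-- The rotation of the circle at infinity through `u` full turns. -/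
noncomputable def turn (u : ℝ) : PSL2R := proj (rotation (2 * Real.pi * u))

theorem continuous_turn : Continuous turn :=
  continuous_proj.comp (continuous_rotation.comp (by fun_prop))

theorem dir_turn (u : ℝ) : dir (turn u) = circ u := dirSL_rotation _

theorem rotation_add (φ ψ : ℝ) : rotation (φ + ψ) = rotation φ * rotation ψ := by
  obtain ⟨h₁, h₂, h₃, h₄⟩ := rotation_entries φ
  obtain ⟨k₁, k₂, k₃, k₄⟩ := rotation_entries ψ
  obtain ⟨l₁, l₂, l₃, l₄⟩ := rotation_entries (φ + ψ)
  apply ext_entries <;> rw [mul_entry] <;>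
    simp only [h₁, h₂, h₃, h₄, k₁, k₂, k₃, k₄, l₁, l₂, l₃, l₄, add_div, Real.cos_add,
      Real.sin_add] <;> ring

theorem turn_add (u v : ℝ) : turn (u + v) = turn u * turn v := by
  rw [turn, mul_add, rotation_add]; rfl

theorem turn_zero : turn 0 = 1 := by rw [turn, mul_zero, rotation_zero]; rfl

theorem rotation_two_pi : rotation (2 * Real.pi) = -1 := by
  ext i j
  fin_cases i <;> fin_cases j <;> simp [rotation]

theorem turn_one : turn 1 = 1 := by
  rw [turn, mul_one, rotation_two_pi, proj_neg]; rfl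

/-! ### Iwasawa coordinates. -/

/-- The upper triangular matrix with diagonal entries `exp s`, `exp (-s)`. -/
noncomputable def upper (s q : ℝ) : SpecialLinearGroup (Fin 2) ℝ :=
  ⟨!![Real.exp s, q * Real.exp (-s); 0, Real.exp (-s)], by
    rw [Matrix.det_fin_two_of, ← Real.exp_add]; simp⟩

theorem upper_entries (s q : ℝ) :
    upper s q 0 0 = Real.exp s ∧ upper s q 0 1 = q * Real.exp (-s) ∧
    upper s q 1 0 = 0 ∧ upper s q 1 1 = Real.exp (-s) :=
  ⟨rfl, rfl, rfl, rfl⟩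

theorem continuous_upper : Continuous fun p : ℝ × ℝ => upper p.1 p.2 := by
  refine Continuous.subtype_mk (continuous_matrix fun i j => ?_) _
  fin_cases i <;> fin_cases j <;> simp <;> fun_prop

/-- Iwasawa coordinates on `PSL₂(ℝ)`. -/
noncomputable def iwasawa (u s q : ℝ) : PSL2R := turn u * proj (upper s q)

theorem continuous_iwasawa : Continuous fun p : ℝ × ℝ × ℝ => iwasawa p.1 p.2.1 p.2.2 :=
  (continuous_turn.comp continuous_fst).mul
    (continuous_proj.comp (continuous_upper.comp continuous_snd))

/-- Logarithm of the norm of the first column. -/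
noncomputable def logNorm : PSL2R → ℝ :=
  descend (fun A => Real.log (A 0 0 ^ 2 + A 1 0 ^ 2) / 2) (fun A => by simp)

/-- Inner product of the two columns. -/
noncomputable def shear : PSL2R → ℝ :=
  descend (fun A => A 0 0 * A 0 1 + A 1 0 * A 1 1) (fun A => by simp)

theorem sq_add_sq_pos (A : SpecialLinearGroup (Fin 2) ℝ) : 0 < A 0 0 ^ 2 + A 1 0 ^ 2 := by
  rcases eq_or_ne (A 0 0) 0 with h | h
  · have h1 : A 1 0 ≠ 0 := fun h1 => by simpa [h, h1] using det_eq A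
    positivity
  · positivity

theorem continuous_logNorm : Continuous logNorm := by
  refine continuous_descend _ (Continuous.div_const (Continuous.log ?_ fun A =>
    (sq_add_sq_pos A).ne') 2)
  exact ((continuous_entry 0 0).pow 2).add ((continuous_entry 1 0).pow 2)

theorem continuous_shear : Continuous shear :=
  continuous_descend _ (((continuous_entry 0 0).mul (continuous_entry 0 1)).add
    ((continuous_entry 1 0).mul (continuous_entry 1 1)))

/-- Undoing the rotation that carries the base point to `dir x` leaves an upper triangular matrix,
determined by the norm of the first column and the inner product of the columns. -/
theorem eq_iwasawa {x : PSL2R} {u : ℝ} (h : circ u = dir x) :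
    x = iwasawa u (logNorm x) (shear x) := by
  obtain ⟨A, rfl⟩ := proj_surjective x
  rw [← dir_turn] at h
  have hd := dirSL_eq_iff.mp h
  set φ := 2 * Real.pi * u with hφ
  have hdet := det_eq A
  have hpos := sq_add_sq_pos A
  have hcs := Real.cos_sq_add_sin_sq (φ / 2)
  simp only [rotation, Matrix.of_apply, Matrix.cons_val_zero, Matrix.cons_val_one,
    Matrix.cons_val', Matrix.cons_val_fin_one] at hd
  change proj A = proj (rotation φ * upper (Real.log (A 0 0 ^ 2 + A 1 0 ^ 2) / 2)
    (A 0 0 * A 0 1 + A 1 0 * A 1 1))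
  set r := Real.exp (Real.log (A 0 0 ^ 2 + A 1 0 ^ 2) / 2) with hr
  have hr0 : 0 < r := Real.exp_pos _
  have hr2 : r ^ 2 = A 0 0 ^ 2 + A 1 0 ^ 2 := by
    rw [hr, ← Real.exp_nat_mul, Nat.cast_ofNat, mul_div_cancel₀ _ two_ne_zero, Real.exp_log hpos]
  have hri : Real.exp (-(Real.log (A 0 0 ^ 2 + A 1 0 ^ 2) / 2)) = r⁻¹ := by rw [Real.exp_neg]
  set C := Real.cos (φ / 2)
  set S := Real.sin (φ / 2)
  -- `e` is the signed length of the first column along that of the rotation; the choice `e = ± r`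
  -- is the sign lost in `PSL₂(ℝ)`.
  obtain ⟨e, he⟩ : ∃ e, e = A 0 0 * C - A 1 0 * S := ⟨_, rfl⟩
  have ha : A 0 0 = e * C := by rw [he]; linear_combination (-A 0 0) * hcs + S * hd
  have hc : A 1 0 = -(e * S) := by rw [he]; linear_combination (-A 1 0) * hcs + C * hd
  have he2 : e ^ 2 = r ^ 2 := by rw [hr2, ha, hc]; linear_combination (-e ^ 2) * hcs
  have hb : A 0 1 * r ^ 2 = (A 0 0 * A 0 1 + A 1 0 * A 1 1) * (e * C) + e * S := by
    rw [hr2]; linear_combination (-A 1 0) * hdet - hc + (A 0 0 * A 0 1 + A 1 0 * A 1 1) * ha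
  have hdd : A 1 1 * r ^ 2 = -(A 0 0 * A 0 1 + A 1 0 * A 1 1) * (e * S) + e * C := by
    rw [hr2]; linear_combination (A 0 0) * hdet + ha + (A 0 0 * A 0 1 + A 1 0 * A 1 1) * hc
  generalize A 0 0 * A 0 1 + A 1 0 * A 1 1 = q at *
  have hsplit : proj A = proj (rotation φ * upper (Real.log (A 0 0 ^ 2 + A 1 0 ^ 2) / 2) q) := by
    obtain ⟨h₁, h₂, h₃, h₄⟩ := rotation_entries φ
    obtain ⟨k₁, k₂, k₃, k₄⟩ := upper_entries (Real.log (A 0 0 ^ 2 + A 1 0 ^ 2) / 2) q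
    rw [hri] at k₂ k₄
    rw [← hr] at k₁
    rw [proj_eq_iff]
    rcases sq_eq_sq_iff_eq_or_eq_neg.mp he2 with rfl | rfl
    · left
      apply ext_entries <;> rw [mul_entry] <;> simp only [h₁, h₂, h₃, h₄, k₁, k₂, k₃, k₄]
      · linear_combination ha
      · field_simp; apply mul_left_cancel₀ hr0.ne'; linear_combination hb
      · linear_combination hc
      · field_simp; apply mul_left_cancel₀ hr0.ne'; linear_combination hdd
    · right
      apply ext_entries <;> rw [neg_entry, mul_entry] <;> simp only [h₁, h₂, h₃, h₄, k₁, k₂, k₃, k₄]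
      · linear_combination ha
      · field_simp; apply mul_left_cancel₀ hr0.ne'; linear_combination hb
      · linear_combination hc
      · field_simp; apply mul_left_cancel₀ hr0.ne'; linear_combination hdd
  exact hsplit

/-! ### The lifted action on the line. -/

/-- The motion of the point `u` of the circle at infinity along a path of isometries. -/
noncomputable def orbitMap (γ : basedPaths PSL2R) : C(unitInterval × ℝ, Circle) :=
  ⟨fun p => dir (γ.1 p.1 * turn p.2), continuous_dir.comp
    ((γ.1.continuous.comp continuous_fst).mul (continuous_turn.comp continuous_snd))⟩

theorem orbitMap_zero (γ : basedPaths PSL2R) (u : ℝ) :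
    orbitMap γ (0, u) = circ ((ContinuousMap.id ℝ) u) := by
  have h : γ.1 0 = 1 := γ.2
  change dir (γ.1 0 * turn u) = circ u
  rw [h, one_mul, dir_turn]

/-- The lift to the line of the action of a path of isometries on the circle at infinity. -/
noncomputable def orbitLift (γ : basedPaths PSL2R) : C(unitInterval × ℝ, ℝ) :=
  isCoveringMap_circ.liftHomotopy (orbitMap γ) (ContinuousMap.id ℝ) (orbitMap_zero γ)

theorem orbitLift_zero (γ : basedPaths PSL2R) (u : ℝ) : orbitLift γ (0, u) = u :=
  isCoveringMap_circ.liftHomotopy_zero _ _ _ u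

theorem circ_orbitLift (γ : basedPaths PSL2R) (t : unitInterval) (u : ℝ) :
    circ (orbitLift γ (t, u)) = dir (γ.1 t * turn u) :=
  congrFun (isCoveringMap_circ.liftHomotopy_lifts (orbitMap γ) _ (orbitMap_zero γ)) (t, u)

theorem orbitLift_unique (γ : basedPaths PSL2R) {u : ℝ} {φ : unitInterval → ℝ} (hφ : Continuous φ)
    (h0 : φ 0 = u) (h : ∀ t, circ (φ t) = dir (γ.1 t * turn u)) (t : unitInterval) :
    orbitLift γ (t, u) = φ t := by
  refine congrFun (isCoveringMap_circ.eq_of_comp_eq (g₁ := fun t => orbitLift γ (t, u)) (g₂ := φ)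
    (by fun_prop) hφ (funext fun t => ?_) 0 ?_) t
  · exact (circ_orbitLift γ t u).trans (h t).symm
  · exact (orbitLift_zero γ u).trans h0.symm

theorem orbitLift_one (t : unitInterval) (u : ℝ) : orbitLift 1 (t, u) = u :=
  orbitLift_unique 1 (φ := fun _ => u) continuous_const rfl
    (fun t => by
      change circ u = dir (1 * turn u)
      rw [one_mul, dir_turn]) t

theorem orbitLift_mul (γ δ : basedPaths PSL2R) (t : unitInterval) (u : ℝ) :
    orbitLift (γ * δ) (t, u) = orbitLift γ (t, orbitLift δ (t, u)) := by
  refine orbitLift_unique (γ * δ) (φ := fun t => orbitLift γ (t, orbitLift δ (t, u)))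
    (by fun_prop) ?_ (fun t => ?_) t
  · rw [orbitLift_zero, orbitLift_zero]
  · rw [circ_orbitLift]
    change _ = dir (γ.1 t * δ.1 t * turn u)
    rw [mul_assoc]
    exact dir_mul_congr _ (by rw [dir_turn, circ_orbitLift])

theorem orbitLift_add_one (γ : basedPaths PSL2R) (t : unitInterval) (u : ℝ) :
    orbitLift γ (t, u + 1) = orbitLift γ (t, u) + 1 := by
  refine orbitLift_unique γ (φ := fun t => orbitLift γ (t, u) + 1) (by fun_prop) ?_ (fun t => ?_) t
  · rw [orbitLift_zero]
  · rw [turn_add, turn_one, mul_one, ← circ_orbitLift]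
    exact circ_eq_circ_iff.mpr ⟨1, by simp⟩

/-- The inverse path provides an inverse map, so the map is continuous and injective, hence strictly
monotone; commuting with the unit translation excludes the decreasing case. -/
theorem orbitLift_monotone (γ : basedPaths PSL2R) (t : unitInterval) :
    Monotone fun u => orbitLift γ (t, u) := by
  have hinj : Function.Injective fun u => orbitLift γ (t, u) := by
    refine Function.LeftInverse.injective (g := fun u => orbitLift γ⁻¹ (t, u)) fun u => ?_
    change orbitLift γ⁻¹ (t, orbitLift γ (t, u)) = u
    rw [← orbitLift_mul, inv_mul_cancel, orbitLift_one]
  rcases Continuous.strictMono_of_inj (f := fun u => orbitLift γ (t, u)) (by fun_prop) hinj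
    with h | h
  · exact h.monotone
  · have := h (lt_add_one 0)
    simp only [orbitLift_add_one] at this
    linarith

/-- The homeomorphism of the line defined by a path of isometries. -/
noncomputable def pathAction : basedPaths PSL2R →* CircleDeg1Lift where
  toFun γ := ⟨⟨fun u => orbitLift γ (1, u), orbitLift_monotone γ 1⟩, orbitLift_add_one γ 1⟩
  map_one' := CircleDeg1Lift.ext fun u => orbitLift_one 1 u
  map_mul' γ δ := CircleDeg1Lift.ext fun u => orbitLift_mul γ δ 1 u

/-- A homotopy relative to endpoints induces one between the orbits on the circle, and their lifts
from a common start then have the same end. -/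
theorem pathAction_congr {γ δ : basedPaths PSL2R} (h : pathHomotopyCon PSL2R γ δ) :
    pathAction γ = pathAction δ := by
  refine CircleDeg1Lift.ext fun u => ?_
  obtain ⟨F⟩ := h
  have hF : ((orbitMap γ).comp ((ContinuousMap.id _).prodMk (.const _ u))).HomotopicRel
      ((orbitMap δ).comp ((ContinuousMap.id _).prodMk (.const _ u))) {0, 1} :=
    ⟨{ toFun := fun x => dir (F x * turn u)
       continuous_toFun := continuous_dir.comp (F.continuous.mul continuous_const)
       map_zero_left := fun t => by
        change dir (F (0, t) * turn u) = dir (γ.1 t * turn u)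
        rw [F.apply_zero]
       map_one_left := fun t => by
        change dir (F (1, t) * turn u) = dir (δ.1 t * turn u)
        rw [F.apply_one]
       prop' := fun s t ht => by
        change dir (F (s, t) * turn u) = dir (γ.1 t * turn u)
        rw [F.eq_fst s ht] }⟩
  exact isCoveringMap_circ.liftPath_apply_one_eq_of_homotopicRel hF u
    (orbitMap_zero γ u) (orbitMap_zero δ u)

/-- The action of the universal covering group on the line. -/
noncomputable def lineAction : PSL2RCover →* CircleDeg1Lift :=
  Con.lift _ pathAction fun _ _ h => pathAction_congr h

/-- The covering projection. -/
def endpoint : PSL2RCover →* PSL2R :=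
  Con.lift _ ⟨⟨fun γ => γ.1 1, rfl⟩, fun _ _ => rfl⟩ fun γ δ h => by
    obtain ⟨F⟩ := h
    exact (F.eq_fst 0 (Or.inr rfl)).symm.trans (F.eq_snd 0 (Or.inr rfl))

theorem lineAction_coe (γ : basedPaths PSL2R) (u : ℝ) :
    lineAction (γ : PSL2RCover) u = orbitLift γ (1, u) := rfl

theorem endpoint_coe (γ : basedPaths PSL2R) : endpoint (γ : PSL2RCover) = γ.1 1 := rfl

theorem circ_lineAction (x : PSL2RCover) (u : ℝ) :
    circ (lineAction x u) = dir (endpoint x * turn u) := by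
  induction x using Con.induction_on with
  | H γ => exact circ_orbitLift γ 1 u

/-- Once the angle is lifted to the line, Iwasawa coordinates turn each path into a path in `ℝ³`.
The hypotheses make the ends of the two paths agree there, and convexity supplies the homotopy. -/
theorem eq_of_endpoint_eq {x y : PSL2RCover} (he : endpoint x = endpoint y)
    (hl : lineAction x 0 = lineAction y 0) : x = y := by
  induction x using Con.induction_on with
  | H γ =>
  induction y using Con.induction_on with
  | H δ =>
  rw [endpoint_coe, endpoint_coe] at he
  rw [lineAction_coe, lineAction_coe] at hl
  have hγ0 : γ.1 0 = 1 := γ.2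
  have hδ0 : δ.1 0 = 1 := δ.2
  let c (γ : basedPaths PSL2R) (t : unitInterval) : ℝ × ℝ × ℝ :=
    (orbitLift γ (t, 0), logNorm (γ.1 t), shear (γ.1 t))
  have hc (γ : basedPaths PSL2R) : Continuous (c γ) := by
    have h1 := continuous_logNorm.comp γ.1.continuous
    have h2 := continuous_shear.comp γ.1.continuous
    exact Continuous.prodMk (by fun_prop) (h1.prodMk h2)
  have hiw (γ : basedPaths PSL2R) (t : unitInterval) :
      iwasawa (c γ t).1 (c γ t).2.1 (c γ t).2.2 = γ.1 t :=
    (eq_iwasawa (by rw [circ_orbitLift, turn_zero, mul_one])).symm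
  have hends (t : unitInterval) (ht : t ∈ ({0, 1} : Set unitInterval)) : c δ t = c γ t := by
    rcases ht with rfl | rfl
    · simp only [c, orbitLift_zero, hγ0, hδ0]
    · simp only [c, hl, he]
  refine (Con.eq _).mpr ⟨{
    toFun := fun p => iwasawa (AffineMap.lineMap (c γ p.2) (c δ p.2) (p.1 : ℝ)).1
      (AffineMap.lineMap (c γ p.2) (c δ p.2) (p.1 : ℝ)).2.1
      (AffineMap.lineMap (c γ p.2) (c δ p.2) (p.1 : ℝ)).2.2
    continuous_toFun := ?_
    map_zero_left := fun t => ?_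
    map_one_left := fun t => ?_
    prop' := fun s t ht => ?_ }⟩
  · refine continuous_iwasawa.comp (g := fun p : ℝ × ℝ × ℝ => iwasawa p.1 p.2.1 p.2.2)
      (f := fun p : unitInterval × unitInterval =>
        AffineMap.lineMap (c γ p.2) (c δ p.2) (p.1 : ℝ)) ?_
    have h1 := hc γ
    have h2 := hc δ
    simp only [AffineMap.lineMap_apply]
    fun_prop
  · simp only [Set.Icc.coe_zero, AffineMap.lineMap_apply_zero, hiw]
  · simp only [Set.Icc.coe_one, AffineMap.lineMap_apply_one, hiw]
  · change iwasawa (AffineMap.lineMap (c γ t) (c δ t) (s : ℝ)).1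
      (AffineMap.lineMap (c γ t) (c δ t) (s : ℝ)).2.1
      (AffineMap.lineMap (c γ t) (c δ t) (s : ℝ)).2.2 = γ.1 t
    rw [hends t ht, AffineMap.lineMap_same_apply, hiw]

/-- If a path of conjugates by a fixed element is replaced by conjugation with any lift of that
element, the class does not change. -/
theorem conjPathLift_eq {f : ℝ → SpecialLinearGroup (Fin 2) ℝ} (hf : Continuous f) (h0 : f 0 = 1)
    (g : SpecialLinearGroup (Fin 2) ℝ) (s : ℝ) {w : PSL2RCover} (hw : endpoint w = proj g) :
    conjPathLift f hf h0 g s = w * conjPathLift f hf h0 1 s * w⁻¹ := by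
  induction w using Con.induction_on with
  | H δ =>
  rw [endpoint_coe] at hw
  have hδ0 : δ.1 0 = 1 := δ.2
  refine ((Con.eq _).mpr ?_ : _ = ((δ * _ * δ⁻¹ : basedPaths PSL2R) : PSL2RCover))
  -- At homotopy time `r` the conjugator is `δ (max (1 - r) t)`: it is constantly `δ 1`, a
  -- representative of `g`, when `r = 0`, and `δ t` when `r = 1`. At `t = 0` the conjugated element
  -- is `1`, and at `t = 1` the maximum is `1`, so both ends stay fixed.
  refine ⟨{
    toFun := fun p => δ.1 (max (unitInterval.symm p.1) p.2) *
      proj (1 * f (p.2 * s) * 1⁻¹) * (δ.1 (max (unitInterval.symm p.1) p.2))⁻¹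
    continuous_toFun := ?_
    map_zero_left := fun t => ?_
    map_one_left := fun t => ?_
    prop' := fun r t ht => ?_ }⟩
  · have h1 : Continuous fun p : unitInterval × unitInterval =>
        proj (1 * f (p.2 * s) * 1⁻¹) := continuous_proj.comp (by fun_prop)
    have h2 : Continuous fun p : unitInterval × unitInterval =>
        δ.1 (max (unitInterval.symm p.1) p.2) := by fun_prop
    exact (h2.mul h1).mul h2.inv
  · change δ.1 (max (unitInterval.symm 0) t) * proj (1 * f (t * s) * 1⁻¹) *
      (δ.1 (max (unitInterval.symm 0) t))⁻¹ = proj (g * f (t * s) * g⁻¹)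
    rw [unitInterval.symm_zero, max_eq_left unitInterval.le_one', hw, inv_one, mul_one, one_mul]
    rfl
  · change δ.1 (max (unitInterval.symm 1) t) * proj (1 * f (t * s) * 1⁻¹) *
      (δ.1 (max (unitInterval.symm 1) t))⁻¹ = δ.1 t * proj (1 * f (t * s) * 1⁻¹) * (δ.1 t)⁻¹
    rw [unitInterval.symm_one, max_eq_right unitInterval.nonneg']
  · change δ.1 (max (unitInterval.symm r) t) * proj (1 * f (t * s) * 1⁻¹) *
      (δ.1 (max (unitInterval.symm r) t))⁻¹ = proj (g * f (t * s) * g⁻¹)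
    rcases ht with rfl | rfl
    · rw [Set.Icc.coe_zero, zero_mul, h0, inv_one, mul_one, mul_one, mul_one, mul_inv_cancel,
        proj_one, mul_one, mul_inv_cancel]
    · rw [max_eq_right unitInterval.le_one', hw, inv_one, mul_one, one_mul]
      rfl

/-! ### Conjugacy normal forms in `PSL₂(ℝ)`. -/

/-- Being conjugate in `PSL₂(ℝ)` to a normal form. -/
def HasNormalForm (x : PSL2R) : Prop :=
  x = 1 ∨ (∃ g, ∃ d : ℝ, d ≠ 0 ∧ x = proj (g * translation d * g⁻¹)) ∨
    (∃ g, ∃ d : ℝ, d ≠ 0 ∧ x = proj (g * horocyclic d * g⁻¹)) ∨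
    ∃ g, ∃ ψ : ℝ, 0 < ψ ∧ ψ < 2 * Real.pi ∧ x = proj (g * rotation ψ * g⁻¹)

theorem HasNormalForm.conj {x : PSL2R} (h : HasNormalForm x) (g : SpecialLinearGroup (Fin 2) ℝ) :
    HasNormalForm (proj g * x * (proj g)⁻¹) := by
  have key (k B : SpecialLinearGroup (Fin 2) ℝ) :
      proj g * proj (k * B * k⁻¹) * (proj g)⁻¹ = proj (g * k * B * (g * k)⁻¹) := by
    rw [← proj_inv, ← proj_mul, ← proj_mul, _root_.mul_inv_rev]
    simp only [mul_assoc]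
  rcases h with rfl | ⟨k, d, hd, rfl⟩ | ⟨k, d, hd, rfl⟩ | ⟨k, ψ, h0, h1, rfl⟩
  · exact Or.inl (by rw [mul_one, mul_inv_cancel])
  · exact Or.inr (Or.inl ⟨g * k, d, hd, key _ _⟩)
  · exact Or.inr (Or.inr (Or.inl ⟨g * k, d, hd, key _ _⟩))
  · exact Or.inr (Or.inr (Or.inr ⟨g * k, ψ, h0, h1, key _ _⟩))

theorem translation_entries (d : ℝ) :
    translation d 0 0 = Real.exp (d / 2) ∧ translation d 0 1 = 0 ∧
    translation d 1 0 = 0 ∧ translation d 1 1 = Real.exp (-(d / 2)) :=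
  ⟨rfl, rfl, rfl, rfl⟩

theorem horocyclic_entries (d : ℝ) :
    horocyclic d 0 0 = 1 ∧ horocyclic d 0 1 = d ∧
    horocyclic d 1 0 = 0 ∧ horocyclic d 1 1 = 1 :=
  ⟨rfl, rfl, rfl, rfl⟩

theorem hasNormalForm_of_upper_pos {U : SpecialLinearGroup (Fin 2) ℝ} (h : U 1 0 = 0)
    (hpos : 0 < U 0 0) : HasNormalForm (proj U) := by
  have hdet := det_eq U
  rw [h, mul_zero, sub_zero] at hdet
  rcases eq_or_ne (U 0 0) 1 with h1 | h1
  · have hd : U 1 1 = 1 := by rwa [h1, one_mul] at hdet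
    obtain ⟨k₁, k₂, k₃, k₄⟩ := horocyclic_entries (U 0 1)
    have hU : U = horocyclic (U 0 1) := by
      apply ext_entries <;> simp only [*]
    rcases eq_or_ne (U 0 1) 0 with h2 | h2
    · exact Or.inl (by rw [hU, h2, horocyclic_zero, proj_one])
    · exact Or.inr (Or.inr (Or.inl ⟨1, U 0 1, h2, by rw [← hU, one_mul, inv_one, mul_one]⟩))
  · have hinv : U 1 1 = (U 0 0)⁻¹ := eq_inv_of_mul_eq_one_right hdet
    have hne : U 1 1 - U 0 0 ≠ 0 := fun h0 => h1 (by nlinarith)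
    -- The conjugator carries `0` to the finite fixed point of `w ↦ (a w + b) / d`, namely `b / (d -
    -- a)`.
    refine Or.inr (Or.inl ⟨horocyclic (U 0 1 / (U 1 1 - U 0 0)), 2 * Real.log (U 0 0), ?_, ?_⟩)
    · exact mul_ne_zero two_ne_zero (Real.log_ne_zero_of_pos_of_ne_one hpos h1)
    · obtain ⟨k₁, k₂, k₃, k₄⟩ := horocyclic_entries (U 0 1 / (U 1 1 - U 0 0))
      obtain ⟨l₁, l₂, l₃, l₄⟩ := translation_entries (2 * Real.log (U 0 0))
      rw [mul_div_cancel_left₀ _ two_ne_zero, Real.exp_log hpos] at l₁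
      rw [mul_div_cancel_left₀ _ two_ne_zero, Real.exp_neg, Real.exp_log hpos, ← hinv] at l₄
      congr 1
      rw [eq_mul_inv_iff_mul_eq]
      apply ext_entries <;> rw [mul_entry, mul_entry] <;>
        simp only [k₁, k₂, k₃, k₄, l₁, l₂, l₃, l₄, h] <;> field_simp <;> ring

theorem hasNormalForm_of_upper {U : SpecialLinearGroup (Fin 2) ℝ} (h : U 1 0 = 0) :
    HasNormalForm (proj U) := by
  have hdet := det_eq U
  rw [h, mul_zero, sub_zero] at hdet
  rcases lt_trichotomy (U 0 0) 0 with h0 | h0 | h0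
  · rw [← proj_neg]
    exact hasNormalForm_of_upper_pos (by rw [neg_entry, h, neg_zero])
      (by rw [neg_entry]; linarith)
  · simp [h0] at hdet
  · exact hasNormalForm_of_upper_pos h h0

theorem hasNormalForm_of_four_le {A : SpecialLinearGroup (Fin 2) ℝ}
    (h : 4 ≤ (A 0 0 + A 1 1) ^ 2) : HasNormalForm (proj A) := by
  rcases eq_or_ne (A 1 0) 0 with hc | hc
  · exact hasNormalForm_of_upper hc
  have hdet := det_eq A
  obtain ⟨r, hr⟩ : ∃ r, r ^ 2 = (A 0 0 + A 1 1) ^ 2 - 4 := ⟨_, Real.sq_sqrt (sub_nonneg.mpr h)⟩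
  -- `p` is a real fixed point of the Möbius map, a root of a quadratic with discriminant `tr² - 4`.
  -- The matrix `g` below carries `∞` to `p`, so conjugating by it makes `A` upper triangular.
  set p := (A 0 0 - A 1 1 + r) / (2 * A 1 0) with hp
  have hp' : 2 * A 1 0 * p = A 0 0 - A 1 1 + r := by rw [hp]; field_simp
  let g : SpecialLinearGroup (Fin 2) ℝ := ⟨!![p, -1; 1, 0], by simp [Matrix.det_fin_two_of]⟩
  let k : SpecialLinearGroup (Fin 2) ℝ := ⟨!![0, 1; -1, p], by simp [Matrix.det_fin_two_of]⟩
  have hgk : g⁻¹ = k := by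
    rw [inv_eq_iff_mul_eq_one]
    apply ext_entries <;> rw [mul_entry, one_entry] <;> simp [g, k]
  have hU : (g⁻¹ * A * g) 1 0 = 0 := by
    rw [hgk, mul_entry, mul_entry, mul_entry]
    simp only [g, k, Matrix.of_apply, Matrix.cons_val_zero, Matrix.cons_val_one,
      Matrix.cons_val', Matrix.cons_val_fin_one]
    apply mul_left_cancel₀ (mul_ne_zero four_ne_zero hc)
    linear_combination (2 * A 1 0 * p - (A 0 0 - A 1 1) + r) * hp' + hr + 4 * hdet
  have := (hasNormalForm_of_upper hU).conj g
  rwa [← proj_inv, ← proj_mul, ← proj_mul, show g * (g⁻¹ * A * g) * g⁻¹ = A by group] at this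

/-- The map fixes a point of the upper half plane, and an upper triangular `g` carries `I` to it.
The half trace is `cos (ψ / 2)`; the sign of `A 1 0` matches `-sin (ψ / 2) < 0` and can be arranged
by passing to `-A`. -/
theorem hasNormalForm_of_lt_four_of_neg {A : SpecialLinearGroup (Fin 2) ℝ}
    (h : (A 0 0 + A 1 1) ^ 2 < 4) (hc : A 1 0 < 0) : HasNormalForm (proj A) := by
  have hdet := det_eq A
  obtain ⟨C, hC⟩ : ∃ C, C = (A 0 0 + A 1 1) / 2 := ⟨_, rfl⟩
  have hC2 : C ^ 2 < 1 := by rw [hC]; linarith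
  obtain ⟨hC3, hC4⟩ := abs_lt.mp ((sq_lt_one_iff_abs_lt_one C).mp hC2)
  set S := Real.sqrt (1 - C ^ 2) with hS
  have hS0 : 0 < S := Real.sqrt_pos.mpr (by linarith)
  have hS2 : S ^ 2 = 1 - C ^ 2 := Real.sq_sqrt (by linarith)
  have hpos : 0 < S / (-A 1 0) := div_pos hS0 (by linarith)
  obtain ⟨p, hp0, hp⟩ : ∃ p, 0 < p ∧ p ^ 2 = S / (-A 1 0) :=
    ⟨_, Real.sqrt_pos.mpr hpos, Real.sq_sqrt hpos.le⟩
  have hp' : A 1 0 * p ^ 2 = -S := by rw [hp]; field_simp [hc.ne]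
  obtain ⟨q, hq⟩ : ∃ q, 2 * S * q = p * (A 1 1 - A 0 0) :=
    ⟨p * (A 1 1 - A 0 0) / (2 * S), by field_simp⟩
  let g : SpecialLinearGroup (Fin 2) ℝ :=
    ⟨!![p, q; 0, p⁻¹], by rw [Matrix.det_fin_two_of]; field_simp; ring⟩
  have hg : g 0 0 = p ∧ g 0 1 = q ∧ g 1 0 = 0 ∧ g 1 1 = p⁻¹ := ⟨rfl, rfl, rfl, rfl⟩
  refine Or.inr (Or.inr (Or.inr ⟨g, 2 * Real.arccos C, ?_, ?_, ?_⟩))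
  · linarith [Real.arccos_pos.mpr hC4]
  · linarith [(Real.arccos_le_pi C).lt_of_ne fun h => by
      have := Real.arccos_eq_pi.mp h
      linarith]
  · obtain ⟨k₁, k₂, k₃, k₄⟩ := hg
    obtain ⟨l₁, l₂, l₃, l₄⟩ := rotation_entries (2 * Real.arccos C)
    rw [mul_div_cancel_left₀ _ two_ne_zero] at l₁ l₂ l₃ l₄
    rw [Real.cos_arccos hC3.le hC4.le] at l₁ l₄
    rw [Real.sin_arccos, ← hS] at l₂ l₃
    have hcq : 2 * A 1 0 * q * p = A 0 0 - A 1 1 := by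
      apply mul_left_cancel₀ hS0.ne'
      linear_combination A 1 0 * p * hq + (A 1 1 - A 0 0) * hp'
    congr 1
    rw [eq_mul_inv_iff_mul_eq]
    apply ext_entries <;> rw [mul_entry, mul_entry] <;> simp only [k₁, k₂, k₃, k₄, l₁, l₂, l₃, l₄]
    · rw [hC]
      linear_combination (1 / 2) * hq
    · apply mul_left_cancel₀ hp0.ne'
      have hb : A 0 1 = p ^ 2 * S + p * q * (C - A 0 0) := by
        apply mul_left_cancel₀ hc.ne
        rw [hC] at hS2 ⊢
        linear_combination (-1) * hdet - S * hp' - (A 1 1 - A 0 0) / 4 * hcq + hS2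
      field_simp
      linear_combination hb
    · apply mul_left_cancel₀ hp0.ne'
      field_simp
      linear_combination hp'
    · apply mul_left_cancel₀ hp0.ne'
      field_simp
      rw [hC]
      linear_combination (1 / 2) * hcq

theorem hasNormalForm (x : PSL2R) : HasNormalForm x := by
  obtain ⟨A, rfl⟩ := proj_surjective x
  rcases le_or_gt 4 ((A 0 0 + A 1 1) ^ 2) with h | h
  · exact hasNormalForm_of_four_le h
  rcases lt_trichotomy (A 1 0) 0 with hc | hc | hc
  · exact hasNormalForm_of_lt_four_of_neg h hc
  · exact hasNormalForm_of_upper hc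
  · rw [← proj_neg]
    refine hasNormalForm_of_lt_four_of_neg ?_ (by rw [neg_entry]; linarith)
    rw [neg_entry, neg_entry]
    linarith [neg_sq (A 0 0 + A 1 1), show (-A 0 0 + -A 1 1) ^ 2 = (A 0 0 + A 1 1) ^ 2 by ring]

/-! ### How the explicit lifts move the line, and the kernel of the covering. -/

section conjPathLift

variable {f : ℝ → SpecialLinearGroup (Fin 2) ℝ} (hf : Continuous f) (h0 : f 0 = 1)

theorem endpoint_conjPathLift (g : SpecialLinearGroup (Fin 2) ℝ) (s : ℝ) :
    endpoint (conjPathLift f hf h0 g s) = proj (g * f s * g⁻¹) := by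
  change proj (g * f (((1 : unitInterval) : ℝ) * s) * g⁻¹) = _
  rw [Set.Icc.coe_one, one_mul]

/-- By uniqueness of path lifting, any continuous guess `φ` covering the orbit computes the action.
-/
theorem lineAction_conjPathLift {s u : ℝ} {φ : ℝ → ℝ} (hφ : Continuous φ) (hφ0 : φ 0 = u)
    (h : ∀ t, circ (φ t) = dir (proj (f (t * s)) * turn u)) :
    lineAction (conjPathLift f hf h0 1 s) u = φ 1 := by
  refine (orbitLift_unique _ (φ := fun t : unitInterval => φ t) (by fun_prop)
    (by rwa [Set.Icc.coe_zero]) (fun t => ?_) 1).trans (by rw [Set.Icc.coe_one])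
  change _ = dir (proj (1 * f (t * s) * 1⁻¹) * turn u)
  rw [h, one_mul, inv_one, mul_one]

theorem lineAction_conjPathLift_zero (hU : ∀ t, f t 1 0 = 0) (s : ℝ) :
    lineAction (conjPathLift f hf h0 1 s) 0 = 0 := by
  refine lineAction_conjPathLift hf h0 (φ := fun _ => 0) continuous_const rfl fun t => ?_
  rw [turn_zero, mul_one, ← dir_turn, turn_zero]
  have := dirSL_mul_upper 1 (f (t * s)) (hU _)
  rw [one_mul] at this
  exact this.symm

end conjPathLift

theorem endpoint_surjective : Function.Surjective endpoint := fun x => by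
  rcases hasNormalForm x with rfl | ⟨g, d, -, rfl⟩ | ⟨g, d, -, rfl⟩ | ⟨g, ψ, -, -, rfl⟩
  · exact ⟨1, map_one _⟩
  · exact ⟨_, endpoint_conjPathLift continuous_translation translation_zero g d⟩
  · exact ⟨_, endpoint_conjPathLift continuous_horocyclic horocyclic_zero g d⟩
  · exact ⟨_, endpoint_conjPathLift continuous_rotation rotation_zero g ψ⟩

theorem lineAction_rotationLift (ψ u : ℝ) :
    lineAction (rotationLift 1 ψ) u = u + ψ / (2 * Real.pi) := by
  rw [rotationLift, lineAction_conjPathLift continuous_rotation rotation_zero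
    (φ := fun t => u + t * (ψ / (2 * Real.pi))) (by fun_prop) (by simp) fun t => ?_, one_mul]
  have : proj (rotation (t * ψ)) = turn (t * (ψ / (2 * Real.pi))) := by
    rw [turn]
    congr 2
    field_simp
  rw [this, ← turn_add, dir_turn, add_comm]

theorem lineAction_z_zpow (n : ℤ) (u : ℝ) : lineAction (z ^ n) u = n + u := by
  have h1 : lineAction.toHomUnits z = CircleDeg1Lift.translate (Multiplicative.ofAdd 1) := by
    refine Units.ext (CircleDeg1Lift.ext fun v => ?_)
    rw [CircleDeg1Lift.translate_apply, MonoidHom.coe_toHomUnits, z, lineAction_rotationLift,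
      div_self Real.two_pi_pos.ne', add_comm]
  have h2 : lineAction.toHomUnits (z ^ n) =
      CircleDeg1Lift.translate (Multiplicative.ofAdd (n * 1)) := by
    rw [map_zpow, h1, CircleDeg1Lift.translate_zpow]
  rw [← MonoidHom.coe_toHomUnits, h2, CircleDeg1Lift.translate_apply, mul_one]

theorem endpoint_z_zpow (n : ℤ) : endpoint (z ^ n) = 1 := by
  have : endpoint z = 1 := by
    rw [z, rotationLift, endpoint_conjPathLift, rotation_two_pi, one_mul, inv_one, mul_one,
      proj_neg, proj_one]
  rw [map_zpow, this, _root_.one_zpow]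

theorem commute_z_zpow (n : ℤ) (x : PSL2RCover) : Commute (z ^ n) x := by
  refine eq_of_endpoint_eq ?_ ?_
  · rw [map_mul, map_mul, endpoint_z_zpow, one_mul, mul_one]
  · rw [map_mul, map_mul, CircleDeg1Lift.mul_apply, CircleDeg1Lift.mul_apply, lineAction_z_zpow,
      lineAction_z_zpow, CircleDeg1Lift.map_int_add]

theorem exists_eq_z_zpow_mul {x y : PSL2RCover} (h : endpoint x = endpoint y) :
    ∃ n : ℤ, x = z ^ n * y := by
  obtain ⟨n, hn⟩ : ∃ n : ℤ, lineAction x 0 = lineAction y 0 + n := by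
    rw [← circ_eq_circ_iff, circ_lineAction, circ_lineAction, h]
  refine ⟨n, eq_of_endpoint_eq ?_ ?_⟩
  · rw [map_mul, endpoint_z_zpow, one_mul, h]
  · rw [map_mul, CircleDeg1Lift.mul_apply, lineAction_z_zpow, hn, add_comm]

/-- Away from the fixed point, `k = cot (π u)` is a coordinate on the circle in which `horocyclic x`
is `k ↦ k - x`; `1 / 2 - arctan k / π` is the inverse chart, with values in `(0, 1)`. -/
theorem horocyclic_mul_dir {u k : ℝ} (x : ℝ)
    (hk : k * Real.sin (Real.pi * u) = Real.cos (Real.pi * u)) :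
    circ (1 / 2 - Real.arctan (k - x) / Real.pi) = dir (proj (horocyclic x) * turn u) := by
  rw [← dir_turn]
  have hπ := Real.pi_pos.ne'
  refine dirSL_eq_iff.mpr ?_
  obtain ⟨h₁, h₂, h₃, h₄⟩ := horocyclic_entries x
  obtain ⟨l₁, -, l₃, -⟩ := rotation_entries (2 * Real.pi * u)
  obtain ⟨m₁, -, m₃, -⟩ := rotation_entries (2 * Real.pi * (1 / 2 - Real.arctan (k - x) / Real.pi))
  rw [show 2 * Real.pi * u / 2 = Real.pi * u by ring] at l₁ l₃
  rw [show 2 * Real.pi * (1 / 2 - Real.arctan (k - x) / Real.pi) / 2 =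
    Real.pi / 2 - Real.arctan (k - x) by field_simp] at m₁ m₃
  rw [Real.cos_pi_div_two_sub] at m₁
  rw [Real.sin_pi_div_two_sub] at m₃
  rw [mul_entry, mul_entry]
  simp only [h₁, h₂, h₃, h₄, l₁, l₃, m₁, m₃]
  have := Real.tan_mul_cos (Real.cos_arctan_pos (k - x)).ne'
  rw [Real.tan_arctan] at this
  rw [← this]
  linear_combination (-Real.cos (Real.arctan (k - x))) * hk

theorem exists_lineAction_horocyclicLift {u : ℝ} (h0 : 0 < u) (h1 : u < 1) :
    ∃ k, u = 1 / 2 - Real.arctan k / Real.pi ∧ ∀ d,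
      lineAction (horocyclicLift 1 d) u = 1 / 2 - Real.arctan (k - d) / Real.pi := by
  have hπ := Real.pi_pos
  have hsin : Real.sin (Real.pi * u) ≠ 0 :=
    (Real.sin_pos_of_pos_of_lt_pi (by positivity) (by nlinarith)).ne'
  have hu : u = 1 / 2 - Real.arctan (Real.tan (Real.pi / 2 - Real.pi * u)) / Real.pi := by
    rw [Real.arctan_tan (by nlinarith) (by nlinarith)]
    field_simp
    ring
  refine ⟨_, hu, fun d => ?_⟩
  rw [horocyclicLift, lineAction_conjPathLift continuous_horocyclic horocyclic_zero
    (φ := fun t => 1 / 2 - Real.arctan (Real.tan (Real.pi / 2 - Real.pi * u) - t * d) / Real.pi)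
    (by fun_prop) (by rw [zero_mul, sub_zero, ← hu]) fun t => horocyclic_mul_dir _ ?_, one_mul]
  rw [Real.tan_eq_sin_div_cos, Real.cos_pi_div_two_sub, Real.sin_pi_div_two_sub,
    div_mul_cancel₀ _ hsin]

theorem lineAction_horocyclicLift_zero (d : ℝ) : lineAction (horocyclicLift 1 d) 0 = 0 :=
  lineAction_conjPathLift_zero _ _ (fun _ => rfl) d

theorem lineAction_translationLift_zero (d : ℝ) : lineAction (translationLift 1 d) 0 = 0 :=
  lineAction_conjPathLift_zero _ _ (fun _ => rfl) d

theorem le_lineAction_horocyclicLift {d : ℝ} (hd : 0 < d) (u : ℝ) :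
    u ≤ lineAction (horocyclicLift 1 d) u := by
  -- Displacement is periodic, so `u` may be replaced by its fractional part: either the fixed point
  -- `0` or a point of the cotangent chart.
  rw [← sub_nonneg, ← CircleDeg1Lift.map_fract_sub_fract_eq, sub_nonneg]
  rcases (Int.fract_nonneg u).eq_or_lt with h | h
  · rw [← h, lineAction_horocyclicLift_zero]
  · obtain ⟨k, hk, hl⟩ := exists_lineAction_horocyclicLift h (Int.fract_lt_one u)
    rw [hl]
    conv_lhs => rw [hk]
    have : Real.arctan (k - d) ≤ Real.arctan k := Real.arctan_strictMono.monotone (by linarith)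
    have hπ := Real.pi_pos
    gcongr

theorem lineAction_horocyclicLift_le {d : ℝ} (hd : d < 0) (u : ℝ) :
    lineAction (horocyclicLift 1 d) u ≤ u := by
  rw [← sub_nonpos, ← CircleDeg1Lift.map_fract_sub_fract_eq, sub_nonpos]
  rcases (Int.fract_nonneg u).eq_or_lt with h | h
  · rw [← h, lineAction_horocyclicLift_zero]
  · obtain ⟨k, hk, hl⟩ := exists_lineAction_horocyclicLift h (Int.fract_lt_one u)
    rw [hl]
    conv_rhs => rw [hk]
    have : Real.arctan k ≤ Real.arctan (k - d) := Real.arctan_strictMono.monotone (by linarith)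
    have hπ := Real.pi_pos
    gcongr

end PSL2

/-! ### Displacement of commutators. -/

/-- A commutator of homeomorphisms of the line commuting with the unit translation moves some
point by less than one to the right. -/
theorem CircleDeg1Lift.exists_commutator_lt_add_one {G : Type*} [Group G]
    (ρ : G →* CircleDeg1Lift) (a b : G) : ∃ u, ρ (a * b * a⁻¹ * b⁻¹) u < u + 1 := by
  by_contra! h
  -- Since `ab = [a, b] ba`, the displacement assumption at the point `ρ (b * a) u` compares the two
  -- products.
  have hle : (CircleDeg1Lift.translate (Multiplicative.ofAdd 1) : CircleDeg1Lift) * ρ (b * a) ≤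
      ρ (a * b) := fun u => by
    have := h (ρ (b * a) u)
    rw [← CircleDeg1Lift.mul_apply, ← map_mul,
      show a * b * a⁻¹ * b⁻¹ * (b * a) = a * b by group] at this
    rw [CircleDeg1Lift.mul_apply, CircleDeg1Lift.translate_apply]
    linarith
  have hτ := CircleDeg1Lift.translationNumber_mono hle
  have hcomm : Commute (CircleDeg1Lift.translate (Multiplicative.ofAdd 1) : CircleDeg1Lift)
      (ρ (b * a)) := CircleDeg1Lift.ext fun u => by
    simp only [CircleDeg1Lift.mul_apply, CircleDeg1Lift.translate_apply,
      CircleDeg1Lift.map_one_add]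
  have hconj : CircleDeg1Lift.translationNumber (ρ (b * a)) =
      CircleDeg1Lift.translationNumber (ρ (a * b)) := by
    rw [← CircleDeg1Lift.translationNumber_conj_eq (ρ.toHomUnits b) (ρ (a * b)), ← map_inv,
      MonoidHom.coe_toHomUnits, MonoidHom.coe_toHomUnits, ← map_mul, ← map_mul]
    congr 2
    group
  rw [CircleDeg1Lift.translationNumber_mul_of_commute hcomm,
    CircleDeg1Lift.translationNumber_translate, hconj] at hτ
  linarith

/-- The inverse of `[a, b]` is `[b, a]`, so the rightward bound for `[b, a]` at `v` becomes a
leftward bound at the image of `v`. -/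
theorem CircleDeg1Lift.exists_sub_one_lt_commutator {G : Type*} [Group G]
    (ρ : G →* CircleDeg1Lift) (a b : G) : ∃ u, u - 1 < ρ (a * b * a⁻¹ * b⁻¹) u := by
  obtain ⟨v, hv⟩ := CircleDeg1Lift.exists_commutator_lt_add_one ρ b a
  refine ⟨ρ (b * a * b⁻¹ * a⁻¹) v, ?_⟩
  rw [← CircleDeg1Lift.mul_apply, ← map_mul,
    show a * b * a⁻¹ * b⁻¹ * (b * a * b⁻¹ * a⁻¹) = 1 by group, map_one]
  change _ < v
  linarith

namespace PSL2

/-- The property of commutators that is used: some point of the line moves right by less than `1`,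
and some point moves left by less than `1`. -/
def ShortMove (x : PSL2RCover) : Prop :=
  (∃ u, lineAction x u < u + 1) ∧ ∃ u, u - 1 < lineAction x u

theorem shortMove_conj_commutator (a b w : PSL2RCover) :
    ShortMove (w⁻¹ * (a * b * a⁻¹ * b⁻¹) * w) := by
  have h : w⁻¹ * (a * b * a⁻¹ * b⁻¹) * w = (w⁻¹ * a * w) * (w⁻¹ * b * w) * (w⁻¹ * a * w)⁻¹ *
    (w⁻¹ * b * w)⁻¹ := by group
  rw [h]
  exact ⟨CircleDeg1Lift.exists_commutator_lt_add_one _ _ _,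
    CircleDeg1Lift.exists_sub_one_lt_commutator _ _ _⟩

theorem lineAction_z_zpow_mul (n : ℤ) (x : PSL2RCover) (u : ℝ) :
    lineAction (z ^ n * x) u = n + lineAction x u := by
  rw [map_mul, CircleDeg1Lift.mul_apply, lineAction_z_zpow]

theorem ShortMove.lt_one {n : ℤ} {x : PSL2RCover} (h : ShortMove (z ^ n * x))
    (hx : ∀ u, u ≤ lineAction x u) : n < 1 := by
  obtain ⟨u, hu⟩ := h.1
  rw [lineAction_z_zpow_mul] at hu
  have := hx u
  exact_mod_cast (by linarith : (n : ℝ) < 1)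

theorem ShortMove.neg_one_lt {n : ℤ} {x : PSL2RCover} (h : ShortMove (z ^ n * x))
    (hx : ∀ u, lineAction x u ≤ u) : -1 < n := by
  obtain ⟨u, hu⟩ := h.2
  rw [lineAction_z_zpow_mul] at hu
  have := hx u
  exact_mod_cast (by push_cast; linarith : ((-1 : ℤ) : ℝ) < n)

/-- Fixing `0` means fixing every integer, so by monotonicity `f u ≥ ⌊u⌋`. -/
theorem _root_.CircleDeg1Lift.sub_one_lt_of_map_zero (f : CircleDeg1Lift) (h : f 0 = 0) (u : ℝ) :
    u - 1 < f u := by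
  have h1 := f.map_int_add ⌊u⌋ 0
  have h2 := f.monotone (Int.floor_le u)
  rw [add_zero, h, add_zero] at h1
  linarith [Int.lt_floor_add_one u]

theorem _root_.CircleDeg1Lift.lt_add_one_of_map_zero (f : CircleDeg1Lift) (h : f 0 = 0) (u : ℝ) :
    f u < u + 1 := by
  have h1 := f.map_int_add ⌈u⌉ 0
  have h2 := f.monotone (Int.le_ceil u)
  rw [add_zero, h, add_zero] at h1
  linarith [Int.ceil_lt_add_one u]

theorem ShortMove.bounds_of_map_zero {n : ℤ} {x : PSL2RCover} (h : ShortMove (z ^ n * x))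
    (hx : lineAction x 0 = 0) : -1 ≤ n ∧ n ≤ 1 := by
  obtain ⟨⟨u, hu⟩, v, hv⟩ := h
  rw [lineAction_z_zpow_mul] at hu hv
  have h1 := (lineAction x).sub_one_lt_of_map_zero hx u
  have h2 := (lineAction x).lt_add_one_of_map_zero hx v
  have h3 : n < 2 := by exact_mod_cast (by linarith : (n : ℝ) < 2)
  have h4 : -2 < n := by exact_mod_cast (by push_cast; linarith : ((-2 : ℤ) : ℝ) < n)
  omega

theorem rotationLift_sub_two_pi (g : Matrix.SpecialLinearGroup (Fin 2) ℝ) (ψ : ℝ) :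
    z ^ (-1 : ℤ) * rotationLift g ψ = rotationLift g (ψ - 2 * Real.pi) := by
  obtain ⟨w, hw⟩ := endpoint_surjective (proj g)
  have h1 : z ^ (-1 : ℤ) * rotationLift 1 ψ = rotationLift 1 (ψ - 2 * Real.pi) := by
    refine eq_of_endpoint_eq ?_ ?_
    · rw [map_mul, endpoint_z_zpow, one_mul, rotationLift, rotationLift, endpoint_conjPathLift,
        endpoint_conjPathLift, one_mul, one_mul, inv_one, mul_one, mul_one,
        show ψ = ψ - 2 * Real.pi + 2 * Real.pi by ring, rotation_add, rotation_two_pi, mul_neg,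
        mul_one, proj_neg, sub_add_cancel]
    · rw [lineAction_z_zpow_mul, lineAction_rotationLift, lineAction_rotationLift, sub_div,
        div_self Real.two_pi_pos.ne']
      push_cast
      ring
  rw [rotationLift, rotationLift, conjPathLift_eq _ _ g ψ hw, conjPathLift_eq _ _ g _ hw]
  rw [← rotationLift, ← rotationLift, ← h1, ← mul_assoc, ← mul_assoc, ← mul_assoc,
    (commute_z_zpow (-1) w).eq]

/-- Conjugating by a lift of `g` removes `g` from the path and leaves the central factor `z ^ n`
alone. A conjugate of a commutator is a commutator, so the displacement bounds apply to the standard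
path. -/
theorem conjPathLift_decomposition {f : ℝ → Matrix.SpecialLinearGroup (Fin 2) ℝ}
    (hf : Continuous f) (h0 : f 0 = 1) {g : Matrix.SpecialLinearGroup (Fin 2) ℝ} {s : ℝ}
    {a b : PSL2RCover} (h : endpoint (a * b * a⁻¹ * b⁻¹) = proj (g * f s * g⁻¹)) :
    ∃ n : ℤ, a * b * a⁻¹ * b⁻¹ = z ^ n * conjPathLift f hf h0 g s ∧
      ShortMove (z ^ n * conjPathLift f hf h0 1 s) := by
  obtain ⟨n, hn⟩ := exists_eq_z_zpow_mul (h.trans (endpoint_conjPathLift hf h0 g s).symm)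
  obtain ⟨w, hw⟩ := endpoint_surjective (proj g)
  refine ⟨n, hn, ?_⟩
  have := shortMove_conj_commutator a b w
  rwa [hn, conjPathLift_eq hf h0 g s hw, ← mul_assoc, ← (commute_z_zpow n w⁻¹).eq, mul_assoc,
    mul_assoc, mul_assoc, inv_mul_cancel, mul_one, inv_mul_cancel_left] at this

end PSL2

/-! ### The possible powers of `z` for each normal form. -/

open Pointwise in
theorem mainTheorem5 (a b : PSL2.PSL2RCover) :
    a * b * a⁻¹ * b⁻¹ ∈ ({1} : Set PSL2.PSL2RCover) ∪
      (⋃ n ∈ Set.Icc (-1 : ℤ) 1, PSL2.Hyp n ∪ PSL2.Ell n) ∪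
      PSL2.Par 0 ∪ PSL2.ParPos (-1) ∪ PSL2.ParNeg 1 := by
  simp only [Set.mem_union, Set.mem_iUnion, Set.mem_singleton_iff]
  rcases PSL2.hasNormalForm (PSL2.endpoint (a * b * a⁻¹ * b⁻¹)) with
    h | ⟨g, d, hd, h⟩ | ⟨g, d, hd, h⟩ | ⟨g, ψ, hψ0, hψ1, h⟩
  · obtain ⟨n, hn⟩ := PSL2.exists_eq_z_zpow_mul (h.trans (map_one PSL2.endpoint).symm)
    have hs := PSL2.shortMove_conj_commutator a b 1
    rw [inv_one, one_mul, mul_one, hn] at hs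
    have h1 := hs.lt_one fun u => by rw [map_one]; exact le_rfl
    have h2 := hs.neg_one_lt fun u => by rw [map_one]; exact le_rfl
    obtain rfl : n = 0 := by omega
    exact Or.inl (Or.inl (Or.inl (Or.inl (by rw [hn, zpow_zero, one_mul]))))
  · obtain ⟨n, hn, hs⟩ := PSL2.conjPathLift_decomposition PSL2.continuous_translation
      PSL2.translation_zero h
    have hb := hs.bounds_of_map_zero (PSL2.lineAction_translationLift_zero d)
    refine Or.inl (Or.inl (Or.inl (Or.inr ⟨n, hb, Or.inl ?_⟩)))
    rw [hn]
    exact Set.smul_mem_smul_set ⟨g, d, hd, rfl⟩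
  · obtain ⟨n, hn, hs⟩ := PSL2.conjPathLift_decomposition PSL2.continuous_horocyclic
      PSL2.horocyclic_zero h
    have hb := hs.bounds_of_map_zero (PSL2.lineAction_horocyclicLift_zero d)
    rcases hd.lt_or_gt with hd | hd
    · have h1 := hs.neg_one_lt (PSL2.lineAction_horocyclicLift_le hd)
      have hmem : a * b * a⁻¹ * b⁻¹ ∈ PSL2.ParNeg n := by
        rw [hn]
        exact Set.smul_mem_smul_set ⟨g, d, hd, rfl⟩
      obtain rfl | rfl : n = 0 ∨ n = 1 := by omega
      · exact Or.inl (Or.inl (Or.inr (Or.inr hmem)))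
      · exact Or.inr hmem
    · have h1 := hs.lt_one (PSL2.le_lineAction_horocyclicLift hd)
      have hmem : a * b * a⁻¹ * b⁻¹ ∈ PSL2.ParPos n := by
        rw [hn]
        exact Set.smul_mem_smul_set ⟨g, d, hd, rfl⟩
      obtain rfl | rfl : n = 0 ∨ n = -1 := by omega
      · exact Or.inl (Or.inl (Or.inr (Or.inl hmem)))
      · exact Or.inl (Or.inr hmem)
  · obtain ⟨n, hn, hs⟩ := PSL2.conjPathLift_decomposition PSL2.continuous_rotation
      PSL2.rotation_zero h
    have hpos : 0 < ψ / (2 * Real.pi) := div_pos hψ0 Real.two_pi_pos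
    have hlt : ψ / (2 * Real.pi) < 1 := (div_lt_one Real.two_pi_pos).mpr hψ1
    have h1 := hs.lt_one fun u => by
      rw [← PSL2.rotationLift, PSL2.lineAction_rotationLift]; linarith
    have h2 : -2 < n := by
      obtain ⟨u, hu⟩ := hs.2
      rw [PSL2.lineAction_z_zpow_mul, ← PSL2.rotationLift, PSL2.lineAction_rotationLift] at hu
      exact_mod_cast (by push_cast; linarith : ((-2 : ℤ) : ℝ) < n)
    -- Angles are normalised to `(0, 2π)`, so `n = 0` gives `Ell 1`, while `n = -1` subtracts a full
    -- turn and gives the angle `ψ - 2π` of `Ell (-1)`.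
    obtain rfl | rfl : n = 0 ∨ n = -1 := by omega
    · refine Or.inl (Or.inl (Or.inl (Or.inr ⟨1, by norm_num, Or.inr ?_⟩)))
      rw [PSL2.Ell, if_pos one_pos, hn]
      exact Set.smul_mem_smul_set ⟨g, ψ, hψ0, hψ1, rfl⟩
    · refine Or.inl (Or.inl (Or.inl (Or.inr ⟨-1, by norm_num, Or.inr ?_⟩)))
      rw [PSL2.Ell, if_neg (by norm_num), if_pos (by norm_num), hn, ← PSL2.rotationLift,
        PSL2.rotationLift_sub_two_pi, neg_add_cancel, zpow_zero, one_smul]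
      exact ⟨g, ψ - 2 * Real.pi, by linarith, by linarith, rfl⟩
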